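/- Let $(T_t)_{t\ge 0}$ be a subordinator with Bernstein function $f$, i.e. a process with $T_0=0$, stationary and independent increments and almost surely increasing, right-continuous paths such that $\mathbb{E}\,e^{-\lambda T_t}=e^{-tf(\lambda)}$ for all $t,\lambda>0$, where $$f(\lambda)=\beta\lambda+\int_{(0,\infty)}\bigl(1-e^{-\lambda s}\bigr)\,\rho(ds)$$ for some $\beta\ge 0$ and some measure $\rho$ on $(0,\infty)$ with $\int_{(0,\infty)}\min\{s,1\}\,\rho(ds)<\infty$; the same formula defines $f(z)$ for all $z\in\mathbb{C}$ with $\operatorname{Re} z\ge 0$. Assume that $(T_t)_{t\ge0}$ has no strictly positive exponential moments, i.e. $\mathbb{E}\,e^{\alpha T_t}=\infty$ for all $\alpha>0$ and all $t>0$. Let $(R_m)_{m\ge 0}$ be a non-degenerate random walk on $\mathbb{Z}^n$, i.e. $R_0=0$ and the steps $R_{m+1}-R_m$ are independent, identically distributed, $\mathbb{Z}^n$-valued and not almost surely equal to $0$. Put $p_\ell=\mathbb{P}(R_1=\ell)$ and $$\psi_R(\xi)=\sum_{\ell\in\mathbb{Z}^n}p_\ell\bigl(1-e^{i\ell\cdot\xi}\bigr),\qquad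 \psi(\xi)=f(\psi_R(\xi)),\qquad \xi\in\mathbb{R}^n .$$ For a finitely supported sequence $u=(u_k)_{k\in\mathbb{Z}^n}$ of complex numbers let $\mathcal{F}u(\xi)=\sum_{k}u_k e^{-ik\cdot\xi}$ and $$(\psi(D)u)_k=(2\pi)^{-n}\int_{[-\pi,\pi]^n}e^{ik\cdot\xi}\,\psi(\xi)\,\mathcal{F}u(\xi)\,d\xi,\qquad k\in\mathbb{Z}^n .$$ Let $h>1$, let $B_h(0)$ be the open Euclidean ball of radius $h$ around $0$, and let $(u_k)_{k\in\mathbb{Z}^n}$ be a sequence of complex numbers such that $$(\psi(D)u)_k=u_k=0\qquad\text{for all } k\in\mathbb{Z}^n\setminus B_h(0).$$ Then $u_k=0$ for all $k\in\mathbb{Z}^n$. -/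

import Mathlib

open MeasureTheory ProbabilityTheory
open scoped NNReal ENNReal

noncomputable section

namespace DiscreteLevy

/-- The pair `(β, ρ)` is the characteristic pair of a Bernstein function: `β ≥ 0` and `ρ` is a
measure on `(0, ∞)` with `∫ min {t, 1} ρ(dt) < ∞`. Only the restriction of `ρ` to `(0, ∞)` is
ever used. -/
structure IsBernsteinPair (β : ℝ) (ρ : Measure ℝ) : Prop where
  nonneg : 0 ≤ β
  lintegral_lt_top : ∫⁻ t in Set.Ioi (0 : ℝ), ENNReal.ofReal (min t 1) ∂ρ < ∞

/-- The Bernstein function `f(lam) = β lam + ∫_{(0,∞)} (1 - e^{-lam t}) ρ(dt)`, `lam > 0`. -/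
def bernstein (β : ℝ) (ρ : Measure ℝ) (lam : ℝ) : ℝ :=
  β * lam + ∫ t in Set.Ioi (0 : ℝ), (1 - Real.exp (-(lam * t))) ∂ρ

/-- The Bernstein function, given by the same formula on the closed right half-plane `Re z ≥ 0`,
where the integral converges absolutely; this half-plane contains all values of the characteristic
exponent of a random walk. -/
def bernsteinC (β : ℝ) (ρ : Measure ℝ) (z : ℂ) : ℂ :=
  β * z + ∫ t in Set.Ioi (0 : ℝ), (1 - Complex.exp (-(z * (t : ℂ)))) ∂ρ

/-- A subordinator: a process with values in `ℝ` that starts at `0`, has independent and stationary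
increments, and whose paths are almost surely increasing and right-continuous. -/
structure IsSubordinator {Ω : Type*} [MeasurableSpace Ω] (P : Measure Ω) (T : ℝ≥0 → Ω → ℝ) :
    Prop where
  measurable : ∀ t, Measurable (T t)
  zero : ∀ᵐ ω ∂P, T 0 ω = 0
  indep : HasIndepIncrements T P
  stationary : ∀ s t : ℝ≥0, IdentDistrib (fun ω => T (s + t) ω - T s ω) (T t) P P
  paths : ∀ᵐ ω ∂P, Monotone (fun t => T t ω) ∧
    ∀ t, ContinuousWithinAt (fun s => T s ω) (Set.Ici t) t

/-- `T` is a subordinator whose Bernstein function is the one with characteristic pair `(β, ρ)`: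
`E e^{-lam T_t} = e^{-t f(lam)}` for all `t, lam > 0`. -/
structure IsSubordinatorWith {Ω : Type*} [MeasurableSpace Ω] (P : Measure Ω) (T : ℝ≥0 → Ω → ℝ)
    (β : ℝ) (ρ : Measure ℝ) : Prop where
  pair : IsBernsteinPair β ρ
  subordinator : IsSubordinator P T
  laplace : ∀ t : ℝ≥0, 0 < t → ∀ lam : ℝ, 0 < lam →
    ∫ ω, Real.exp (-(lam * T t ω)) ∂P = Real.exp (-((t : ℝ) * bernstein β ρ lam))

/-- `T` has no strictly positive exponential moments: `E e^{α T_t} = ∞` for all `α, t > 0`. -/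
def NoExponentialMoments {Ω : Type*} [MeasurableSpace Ω] (P : Measure Ω) (T : ℝ≥0 → Ω → ℝ) :
    Prop :=
  ∀ α : ℝ, 0 < α → ∀ t : ℝ≥0, 0 < t → ∫⁻ ω, ENNReal.ofReal (Real.exp (α * T t ω)) ∂P = ∞

/-- A non-degenerate random walk on `ℤⁿ`: it starts at `0`, its steps `R (m + 1) - R m` are
independent and identically distributed, and the steps are not almost surely `0`. -/
structure IsRandomWalk {n : ℕ} {Ω : Type*} [MeasurableSpace Ω] (P : Measure Ω)
    (R : ℕ → Ω → (Fin n → ℤ)) : Prop where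
  measurable : ∀ m, Measurable (R m)
  zero : ∀ᵐ ω ∂P, R 0 ω = 0
  indep : iIndepFun (fun (m : ℕ) ω => R (m + 1) ω - R m ω) P
  identDistrib : ∀ m : ℕ, IdentDistrib (fun ω => R (m + 1) ω - R m ω) (R 1) P P
  nondegenerate : ¬ ∀ᵐ ω ∂P, R 1 ω = 0

/-- The step probabilities `p_ℓ = P(R_1 = ℓ)`. -/
def stepProb {n : ℕ} {Ω : Type*} [MeasurableSpace Ω] (P : Measure Ω)
    (R : ℕ → Ω → (Fin n → ℤ)) (l : Fin n → ℤ) : ℝ :=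
  P.real {ω | R 1 ω = l}

/-- The characteristic exponent `ψ_R(ξ) = ∑_ℓ p_ℓ (1 - e^{i ℓ·ξ})`, a `2π`-periodic function of
`ξ ∈ ℝⁿ`, written on the torus `ℝⁿ/ℤⁿ` in the variable `x = ξ / (2π)`; there
`UnitAddTorus.mFourier l x = e^{2πi l·x} = e^{i l·ξ}`. -/
def walkExponent {n : ℕ} {Ω : Type*} [MeasurableSpace Ω] (P : Measure Ω)
    (R : ℕ → Ω → (Fin n → ℤ)) (x : UnitAddTorus (Fin n)) : ℂ :=
  ∑' l : Fin n → ℤ, (stepProb P R l : ℂ) * (1 - UnitAddTorus.mFourier l x)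

/-- The characteristic exponent `ψ = f ∘ ψ_R` of the time-changed process `R_{N_{T_t}}`. -/
def subordinateExponent {n : ℕ} {Ω : Type*} [MeasurableSpace Ω] (P : Measure Ω)
    (R : ℕ → Ω → (Fin n → ℤ)) (β : ℝ) (ρ : Measure ℝ) (x : UnitAddTorus (Fin n)) : ℂ :=
  bernsteinC β ρ (walkExponent P R x)

/-- The Fourier transform (Fourier series) `𝓕u(ξ) = ∑_k u_k e^{-i k·ξ}` of a sequence on `ℤⁿ`,
in the variable `x = ξ / (2π)`. -/
def fourierTransform {n : ℕ} (u : (Fin n → ℤ) → ℂ) (x : UnitAddTorus (Fin n)) : ℂ :=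
  ∑' k : Fin n → ℤ, u k * UnitAddTorus.mFourier (-k) x

/-- The operator `ψ(D) u = 𝓕⁻¹ (ψ 𝓕u)` on sequences on `ℤⁿ`, that is,
`(ψ(D)u)_k = (2π)⁻ⁿ ∫_{[-π,π]ⁿ} e^{i k·ξ} ψ(ξ) 𝓕u(ξ) dξ`. Mathlib's Fourier coefficient of index
`m` integrates against `e^{-i m·ξ}`, hence the index `-k`. -/
def symbolOp {n : ℕ} (psi : UnitAddTorus (Fin n) → ℂ) (u : (Fin n → ℤ) → ℂ) (k : Fin n → ℤ) : ℂ :=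
  UnitAddTorus.mFourierCoeff (fun x => psi x * fourierTransform u x) (-k)

/-- The point `k ∈ ℤⁿ` as an element of the Euclidean space `ℝⁿ`. -/
def latticePoint {n : ℕ} (k : Fin n → ℤ) : EuclideanSpace ℝ (Fin n) :=
  WithLp.toLp 2 (fun i => (k i : ℝ))

end DiscreteLevy

end

/-! The decisive point is that finite support makes the symbol rational on a circle, while
rationality forces exponential moments.

If `u` and `ψ(D)u` both vanish off a finite set `S`, then `ψ · 𝓕u` is a trigonometric polynomial
(`mul_fourierTransform_eq_sum`). Suppose `u ≠ 0`. Choose an integer direction `a` that is injective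
on `S` and satisfies `a·l ≠ 0` for some nonzero step `l` of positive probability
(`exists_dotProduct_ne_zero`). Restricting to the circle `z = e^{2πit}` in direction `a` gives `q(z)
f(1 - ∫ z^k dμ) = p(z)` with polynomials `p` and `q ≠ 0`, where `μ` is the law of `a·R₁`.

The exponent is continuous, so common zeros on the circle cancel and `p/q` is holomorphic on an
annulus. Its negative exponential is the generating function of the mixed compound Poisson law `ν`:
a Poisson number of steps from `μ`, with random parameter `T₁`. Cauchy estimates then give `∫ s^k dν
< ∞` and `∫ s^{-k} dν < ∞` for some `s > 1` (`exists_lintegral_zpow_lt_top`).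

On the other hand `∫ s^k dν = E e^{(M(s)-1)T₁}` with `M(s) = ∫ s^k dμ`, and nondegeneracy of `μ`
makes `M(s)` or `M(s⁻¹)` exceed `1`. So `T₁` has a positive exponential moment, a contradiction
(`not_rational_subordinateExponent`). -/

noncomputable section

namespace DiscreteLevy

/-! ### Bernstein functions and Laplace transforms on the right half-plane. -/

section BernsteinFunction

lemma norm_one_sub_exp_neg_le {w : ℂ} (hw : 0 ≤ w.re) :
    ‖1 - Complex.exp (-w)‖ ≤ ‖w‖ := by
  have hconv : Convex ℝ {z : ℂ | z.re ≤ 0} := convex_halfSpace_re_le 0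
  have h := hconv.norm_image_sub_le_of_norm_deriv_le (f := Complex.exp) (C := 1) (x := -w) (y := 0)
    (fun z _ => Complex.differentiableAt_exp)
    (fun z hz => by
      rw [Complex.deriv_exp, Complex.norm_exp]
      exact Real.exp_le_one_iff.2 hz) (by simpa using hw) (by simp)
  simpa using h

lemma norm_one_sub_exp_neg_le_two {w : ℂ} (hw : 0 ≤ w.re) :
    ‖1 - Complex.exp (-w)‖ ≤ 2 := by
  calc ‖1 - Complex.exp (-w)‖ ≤ ‖(1 : ℂ)‖ + ‖Complex.exp (-w)‖ := norm_sub_le _ _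
    _ ≤ 1 + 1 := by
      gcongr
      · simp
      · rw [Complex.norm_exp]
        exact Real.exp_le_one_iff.2 (by simpa using hw)
    _ = 2 := by norm_num

/-- The linear bound serves for `t ≤ 1` and the bound `2` for `t ≥ 1`. Together they give an
integrable majorant that is locally uniform in `z`. -/
lemma norm_bernstein_integrand_le {z : ℂ} (hz : 0 ≤ z.re) {t : ℝ} (ht : 0 < t) :
    ‖1 - Complex.exp (-(z * (t : ℂ)))‖ ≤ (‖z‖ + 2) * min t 1 := by
  have hre : 0 ≤ (z * (t : ℂ)).re := by
    simpa using mul_nonneg hz ht.le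
  rcases le_total t 1 with h | h
  · rw [min_eq_left h]
    calc _ ≤ ‖z * (t : ℂ)‖ := norm_one_sub_exp_neg_le hre
      _ = ‖z‖ * t := by simp [abs_of_pos ht]
      _ ≤ _ := by nlinarith [norm_nonneg z]
  · rw [min_eq_right h]
    calc _ ≤ (2 : ℝ) := norm_one_sub_exp_neg_le_two hre
      _ ≤ _ := by nlinarith [norm_nonneg z]

variable {β : ℝ} {ρ : Measure ℝ}

lemma IsBernsteinPair.integrable_min (hρ : IsBernsteinPair β ρ) :
    Integrable (fun t : ℝ => min t 1) (ρ.restrict (Set.Ioi 0)) := by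
  refine ⟨by fun_prop, ?_⟩
  rw [hasFiniteIntegral_iff_norm]
  refine lt_of_le_of_lt (le_of_eq ?_) hρ.lintegral_lt_top
  refine setLIntegral_congr_fun measurableSet_Ioi fun t ht => ?_
  have : 0 ≤ min t 1 := le_min (le_of_lt ht) zero_le_one
  simp [abs_of_nonneg this]

lemma IsBernsteinPair.continuousOn (hρ : IsBernsteinPair β ρ) :
    ContinuousOn (bernsteinC β ρ) {z | 0 ≤ z.re} := by
  intro z hz
  refine ContinuousWithinAt.add (by fun_prop) ?_
  refine continuousWithinAt_of_dominated (bound := fun t => (‖z‖ + 1 + 2) * min t 1) ?_ ?_ ?_ ?_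
  · exact Filter.Eventually.of_forall fun w => by fun_prop
  · have h1 : ∀ᶠ w in nhdsWithin z {z | 0 ≤ z.re}, ‖w‖ < ‖z‖ + 1 :=
      (continuous_norm.continuousWithinAt).eventually_lt continuousWithinAt_const (by simp)
    filter_upwards [h1, self_mem_nhdsWithin] with w hw hw0
    filter_upwards [ae_restrict_mem measurableSet_Ioi] with t ht
    have ht' : 0 ≤ min t 1 := le_min (le_of_lt ht) zero_le_one
    exact (norm_bernstein_integrand_le hw0 ht).trans (by gcongr)
  · exact hρ.integrable_min.const_mul _
  · exact Filter.Eventually.of_forall fun t => by fun_prop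

/-- Majorant for the `z`-derivative of the Bernstein integrand on `Re z > ε`; for `t ≥ 1` it comes
from `x e^{-x} ≤ 1` at `x = εt`. -/
lemma mul_exp_neg_le_min {ε t : ℝ} (hε : 0 < ε) (ht : 0 < t) :
    t * Real.exp (-(ε * t)) ≤ (1 + ε⁻¹) * min t 1 := by
  have hε' : 0 < ε⁻¹ := inv_pos.2 hε
  have h1 : Real.exp (-(ε * t)) ≤ 1 := Real.exp_le_one_iff.2 (by nlinarith)
  rcases le_total t 1 with h | h
  · rw [min_eq_left h]
    nlinarith
  · rw [min_eq_right h]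
    have h2 : ε * t ≤ Real.exp (ε * t) := by linarith [Real.add_one_le_exp (ε * t)]
    have h3 : ε * t * Real.exp (-(ε * t)) ≤ 1 := by
      rw [Real.exp_neg, ← div_eq_mul_inv]
      exact div_le_one_of_le₀ h2 (Real.exp_pos _).le
    have h4 : t * Real.exp (-(ε * t)) = ε⁻¹ * (ε * t * Real.exp (-(ε * t))) := by
      field_simp
    rw [h4]
    nlinarith

lemma IsBernsteinPair.differentiableOn (hρ : IsBernsteinPair β ρ) :
    DifferentiableOn ℂ (bernsteinC β ρ) {z | 0 < z.re} := by
  intro z hz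
  refine DifferentiableAt.differentiableWithinAt ?_
  have hz : 0 < z.re := hz
  refine DifferentiableAt.add (by fun_prop) ?_
  set ε := z.re / 2 with hεdef
  have hε : 0 < ε := half_pos hz
  have hs : {w : ℂ | ε < w.re} ∈ nhds z :=
    (isOpen_lt continuous_const Complex.continuous_re).mem_nhds (by
      simp only [Set.mem_ofPred_eq, hεdef]; linarith)
  refine (hasDerivAt_integral_of_dominated_loc_of_deriv_le
    (F := fun (w : ℂ) (t : ℝ) => 1 - Complex.exp (-(w * (t : ℂ))))
    (F' := fun (w : ℂ) (t : ℝ) => (t : ℂ) * Complex.exp (-(w * (t : ℂ))))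
    (bound := fun t => (1 + ε⁻¹) * min t 1) hs ?_ ?_ ?_ ?_ ?_ ?_).2.differentiableAt
  · exact Filter.Eventually.of_forall fun w => by fun_prop
  · refine (hρ.integrable_min.const_mul (‖z‖ + 2)).mono' (by fun_prop) ?_
    filter_upwards [ae_restrict_mem measurableSet_Ioi] with t ht
    exact norm_bernstein_integrand_le hz.le ht
  · fun_prop
  · filter_upwards [ae_restrict_mem measurableSet_Ioi] with t ht w hw
    have ht : 0 < t := ht
    have hw : ε < w.re := hw
    refine le_trans ?_ (mul_exp_neg_le_min hε ht)
    rw [norm_mul, Complex.norm_exp, Complex.norm_real, Real.norm_of_nonneg ht.le]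
    gcongr
    simp only [Complex.neg_re, Complex.mul_re, Complex.ofReal_re, Complex.ofReal_im, mul_zero,
      sub_zero]
    nlinarith
  · exact hρ.integrable_min.const_mul _
  · refine Filter.Eventually.of_forall fun t w _ => ?_
    have h := (((hasDerivAt_id w).mul_const (t : ℂ)).neg.cexp).const_sub 1
    simpa [mul_comm] using! h

lemma bernsteinC_ofReal (lam : ℝ) : bernsteinC β ρ lam = bernstein β ρ lam := by
  unfold bernsteinC bernstein
  push_cast
  congr 1
  rw [← integral_complex_ofReal]
  congr 1 with t
  push_cast
  rfl

lemma bernsteinC_zero : bernsteinC β ρ 0 = 0 := by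
  simp [bernsteinC]

variable {Ω : Type*} [MeasurableSpace Ω] {P : Measure Ω} {T : ℝ≥0 → Ω → ℝ}

lemma IsSubordinator.nonneg (hT : IsSubordinator P T) (t : ℝ≥0) : ∀ᵐ ω ∂P, 0 ≤ T t ω := by
  filter_upwards [hT.zero, hT.paths] with ω h0 h1
  exact h0 ▸ h1.1 (zero_le (a := t))

/-- The Laplace transform identity extends to the open right half-plane. -/
lemma IsSubordinatorWith.laplace_complex [IsProbabilityMeasure P]
    (hT : IsSubordinatorWith P T β ρ) {z : ℂ} (hz : 0 < z.re) :
    ∫ ω, Complex.exp (-(z * T 1 ω)) ∂P = Complex.exp (-bernsteinC β ρ z) := by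
  have hopen : IsOpen {z : ℂ | 0 < z.re} := isOpen_lt continuous_const Complex.continuous_re
  -- Since `T₁ ≥ 0` almost surely, `e^{sT₁}` is bounded for `s < 0`, so the complex moment
  -- generating function is holomorphic on the left half-plane.
  have hexp : Set.Iio (0 : ℝ) ⊆ integrableExpSet (T 1) P := by
    intro s hs
    refine Integrable.of_bound (C := 1)
      (((hT.subordinator.measurable 1).const_mul s).exp.aestronglyMeasurable) ?_
    filter_upwards [hT.subordinator.nonneg 1] with ω hω
    rw [Real.norm_of_nonneg (Real.exp_pos _).le]
    exact Real.exp_le_one_iff.2 (mul_nonpos_of_nonpos_of_nonneg (le_of_lt hs) hω)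
  have hint : Set.Iio (0 : ℝ) ⊆ interior (integrableExpSet (T 1) P) :=
    interior_maximal hexp isOpen_Iio
  have h1 : DifferentiableOn ℂ (fun z : ℂ => complexMGF (T 1) P (-z)) {z | 0 < z.re} := by
    refine differentiableOn_complexMGF.comp (by fun_prop) fun w hw => ?_
    exact hint (by simpa using hw)
  have h2 : DifferentiableOn ℂ (fun z : ℂ => Complex.exp (-bernsteinC β ρ z)) {z | 0 < z.re} :=
    hT.pair.differentiableOn.neg.cexp
  have hpre : IsPreconnected {z : ℂ | 0 < z.re} :=
    (convex_halfSpace_re_gt 0).isPreconnected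
  have hreal : ∀ lam : ℝ, 0 < lam → complexMGF (T 1) P (-(lam : ℂ))
      = Complex.exp (-bernsteinC β ρ lam) := by
    intro lam hlam
    rw [bernsteinC_ofReal, ← Complex.ofReal_neg, complexMGF_ofReal, ← Complex.ofReal_neg,
      ← Complex.ofReal_exp]
    have := hT.laplace 1 one_pos lam hlam
    simp only [NNReal.coe_one, one_mul] at this
    rw [← this]
    simp [mgf]
  -- Identity theorem: the two holomorphic functions agree at real points accumulating at `1`.
  have hfreq : ∃ᶠ w in nhdsWithin (1 : ℂ) {1}ᶜ,
      complexMGF (T 1) P (-w) = Complex.exp (-bernsteinC β ρ w) := by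
    have ht : Filter.Tendsto (fun x : ℝ => (x : ℂ)) (nhdsWithin 1 {1}ᶜ)
        (nhdsWithin (1 : ℂ) {1}ᶜ) := by
      refine tendsto_nhdsWithin_iff.2 ⟨?_, ?_⟩
      · exact (Complex.continuous_ofReal.tendsto' (1 : ℝ) (1 : ℂ) (by simp)).mono_left
          nhdsWithin_le_nhds
      · filter_upwards [self_mem_nhdsWithin] with x hx
        simpa using hx
    refine ht.frequently (Filter.Eventually.frequently ?_)
    filter_upwards [nhdsWithin_le_nhds (Ioi_mem_nhds (zero_lt_one' ℝ))] with x hx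
    exact hreal x hx
  have h := (h1.analyticOnNhd hopen).eqOn_of_preconnected_of_frequently_eq
    (h2.analyticOnNhd hopen) hpre (z₀ := 1) (by simp) hfreq hz
  simpa [complexMGF] using h

/-- The disc `{1 - w : ‖w‖ ≤ 1}` touches the imaginary axis only at `0`. The Laplace identity on the
open half-plane, with its trivial case at `0`, therefore covers all the values needed and no
boundary limit is taken. -/
lemma re_pos_or_eq_zero_of_norm_le_one {w : ℂ} (hw : ‖w‖ ≤ 1) : 0 < (1 - w).re ∨ 1 - w = 0 := by
  have h1 : w.re ≤ 1 := (Complex.re_le_norm w).trans hw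
  rcases h1.lt_or_eq with h | h
  · left; simpa using h
  · right
    have h2 : ‖w‖ ^ 2 = w.re * w.re + w.im * w.im := by
      rw [Complex.sq_norm, Complex.normSq_apply]
    have h3 : w.im = 0 := by
      have : ‖w‖ ^ 2 ≤ 1 := by nlinarith [norm_nonneg w]
      rw [h2, h] at this
      nlinarith [mul_self_nonneg w.im]
    apply Complex.ext <;> simp [h, h3]

lemma IsSubordinatorWith.laplace_one_sub [IsProbabilityMeasure P]
    (hT : IsSubordinatorWith P T β ρ) {w : ℂ} (hw : ‖w‖ ≤ 1) :
    ∫ ω, Complex.exp (-((1 - w) * T 1 ω)) ∂P = Complex.exp (-bernsteinC β ρ (1 - w)) := by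
  rcases re_pos_or_eq_zero_of_norm_le_one hw with h | h
  · exact hT.laplace_complex h
  · simp [h, bernsteinC_zero]

end BernsteinFunction

/-! ### From a rational exponent on the unit circle to exponential moments. -/

/-- Cancelling the common factor: a rational function that agrees with a continuous function on the
unit circle has a representation whose denominator has no zero there. -/
lemma exists_reduced_fraction_on_circle {ψ : ℂ → ℂ} (hψ : ContinuousOn ψ (Metric.sphere 0 1))
    {p q : Polynomial ℂ} (hq : q ≠ 0)
    (h : ∀ z ∈ Metric.sphere (0 : ℂ) 1, q.eval z * ψ z = p.eval z) :
    ∃ p' q' : Polynomial ℂ, q' ≠ 0 ∧ (∀ z ∈ Metric.sphere (0 : ℂ) 1, q'.eval z ≠ 0) ∧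
      ∀ z ∈ Metric.sphere (0 : ℂ) 1, q'.eval z * ψ z = p'.eval z := by
  classical
  set g := EuclideanDomain.gcd p q with hg
  have hg0 : g ≠ 0 := fun h0 => hq (EuclideanDomain.gcd_eq_zero_iff.1 h0).2
  obtain ⟨p', hp'⟩ := EuclideanDomain.gcd_dvd_left p q
  obtain ⟨q', hq'⟩ := EuclideanDomain.gcd_dvd_right p q
  rw [← hg] at hp' hq'
  have hq'0 : q' ≠ 0 := by rintro rfl; simp [hq'] at hq
  have hcop : IsCoprime p' q' := by
    obtain ⟨a, b, hab⟩ : ∃ a b, g = p * a + q * b := ⟨_, _, EuclideanDomain.gcd_eq_gcd_ab p q⟩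
    refine ⟨a, b, mul_left_cancel₀ hg0 ?_⟩
    conv_rhs => rw [mul_one, hab, hp', hq']
    ring
  have hmain : ∀ z ∈ Metric.sphere (0 : ℂ) 1, q'.eval z * ψ z = p'.eval z := by
    intro z hz
    -- The circle has no isolated points and `g` has finitely many zeros, so every `z` is a limit of
    -- circle points where `g` can be cancelled. Continuity of `ψ` then carries the cancelled
    -- identity to `z`.
    have hne : (nhdsWithin z (Metric.sphere 0 1 \ {x | g.eval x = 0})).NeBot := by
      have hfin : {x : ℂ | g.eval x = 0}.Finite := by
        refine (g.roots.toFinset.finite_toSet).subset fun x hx => ?_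
        simpa [hg0] using hx
      have hz1 : AccPt z (Filter.principal (Metric.sphere (0 : ℂ) 1)) := by
        have hpre : IsPreconnected (Metric.sphere (0 : ℂ) 1) :=
          isPreconnected_sphere (by rw [Complex.rank_real_complex]; norm_num) _ _
        refine hpre.preperfect_of_nontrivial ⟨1, by simp, -1, by simp, by norm_num⟩ z hz
      have hopen : ({x : ℂ | g.eval x = 0} \ {z})ᶜ ∈ nhds z :=
        (hfin.subset Set.sdiff_subset).isClosed.isOpen_compl.mem_nhds (by simp)
      rw [accPt_iff_clusterPt] at hz1
      have : (nhdsWithin z (Metric.sphere (0 : ℂ) 1 \ {z})).NeBot := by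
        rw [Set.sdiff_eq, Set.inter_comm, nhdsWithin, ← Filter.inf_principal]
        exact hz1
      rw [nhdsWithin_restrict'' _ (mem_nhdsWithin_of_mem_nhds hopen)] at this
      refine this.mono (nhdsWithin_mono _ ?_)
      rintro x ⟨⟨hx1, hx2⟩, hx3⟩
      exact ⟨hx1, fun hx4 => hx3 ⟨hx4, hx2⟩⟩
    have hc1 : ContinuousWithinAt (fun z => q'.eval z * ψ z)
        (Metric.sphere 0 1 \ {x | g.eval x = 0}) z :=
      (q'.continuous.continuousWithinAt.mul ((hψ z hz).mono Set.sdiff_subset))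
    have hc2 : ContinuousWithinAt (fun z => p'.eval z)
        (Metric.sphere 0 1 \ {x | g.eval x = 0}) z := p'.continuous.continuousWithinAt
    refine tendsto_nhds_unique (hc1.tendsto.congr' ?_) hc2
    filter_upwards [self_mem_nhdsWithin] with x hx
    have := h x hx.1
    rw [hp', hq', Polynomial.eval_mul, Polynomial.eval_mul, mul_assoc] at this
    exact mul_left_cancel₀ hx.2 this
  -- A zero of `q'` on the circle would also be a zero of `p' = q' ψ`, against the Bézout identity.
  refine ⟨p', q', hq'0, fun z hz h0 => ?_, hmain⟩
  have h1 := hmain z hz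
  rw [h0, zero_mul] at h1
  obtain ⟨a, b, hab⟩ := hcop
  have := congrArg (Polynomial.eval z) hab
  simp [h0, ← h1] at this

/-- A polynomial without zeros on the unit circle has none on an annulus around it. -/
lemma exists_annulus_eval_ne_zero {q : Polynomial ℂ} (hq : q ≠ 0)
    (h : ∀ z ∈ Metric.sphere (0 : ℂ) 1, q.eval z ≠ 0) :
    ∃ r : ℝ, 1 < r ∧ ∀ z : ℂ, r⁻¹ ≤ ‖z‖ → ‖z‖ ≤ r → q.eval z ≠ 0 := by
  classical
  have hev : ∀ x ∈ q.roots.toFinset, ∀ᶠ r : ℝ in nhdsWithin 1 (Set.Ioi 1),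
      ¬ (r⁻¹ ≤ ‖x‖ ∧ ‖x‖ ≤ r) := by
    intro x hx
    have hx0 : q.eval x = 0 := by simpa [hq] using hx
    have hx1 : ‖x‖ ≠ 1 := fun hx1 => h x (by simpa using hx1) hx0
    refine Filter.Eventually.filter_mono nhdsWithin_le_nhds ?_
    rcases hx1.lt_or_gt with hlt | hgt
    · have : Filter.Tendsto (fun r : ℝ => r⁻¹) (nhds 1) (nhds 1) := by
        simpa using tendsto_inv₀ (one_ne_zero (α := ℝ))
      filter_upwards [this.eventually_const_lt hlt] with r hr h2
      exact absurd h2.1 (not_le.2 hr)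
    · filter_upwards [eventually_lt_nhds hgt] with r hr h2
      exact absurd h2.2 (not_le.2 hr)
  have hall := (Filter.eventually_all_finset _).2 hev
  obtain ⟨r, hr, hr1⟩ := (hall.and self_mem_nhdsWithin).exists
  refine ⟨r, hr1, fun z h1 h2 h0 => hr z (by simpa [hq] using h0) ⟨h1, h2⟩⟩

lemma circleIntegral_zpow_sub_one (k : ℤ) :
    (∮ z in C(0, 1), z ^ (k - 1)) = if k = 0 then 2 * Real.pi * Complex.I else 0 := by
  split_ifs with hk
  · subst hk
    have := circleIntegral.integral_sub_center_inv (0 : ℂ) (one_ne_zero (α := ℝ))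
    simpa using this
  · have := circleIntegral.integral_sub_zpow_of_ne (n := k - 1) (by omega) 0 0 1
    simpa using this

/-- The atoms of a finite measure on `ℤ` are the Fourier coefficients of its generating function. -/
lemma circleIntegral_generatingFunction (ν : Measure ℤ) [IsFiniteMeasure ν] (k : ℤ) :
    (∮ z in C(0, 1), z⁻¹ * (z ^ (-k) * ∫ j : ℤ, z ^ j ∂ν)) =
      2 * Real.pi * Complex.I * ν.real {k} := by
  have hcm : ∀ θ : ℝ, ‖circleMap 0 1 θ‖ = 1 := fun θ => by simp
  have hcm0 : ∀ θ : ℝ, circleMap 0 1 θ ≠ 0 := fun θ h => by simpa [h] using hcm θ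
  have h1 : (∮ z in C(0, 1), z⁻¹ * (z ^ (-k) * ∫ j : ℤ, z ^ j ∂ν)) =
      ∫ θ in (0 : ℝ)..2 * Real.pi, ∫ j : ℤ,
        deriv (circleMap 0 1) θ * circleMap 0 1 θ ^ (j - k - 1) ∂ν := by
    unfold circleIntegral
    refine intervalIntegral.integral_congr fun θ _ => ?_
    simp only [smul_eq_mul]
    rw [← integral_const_mul, ← integral_const_mul, ← integral_const_mul]
    refine integral_congr_ae (Filter.Eventually.of_forall fun j => ?_)
    simp only
    rw [zpow_sub₀ (hcm0 θ), zpow_sub₀ (hcm0 θ), zpow_neg, zpow_one]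
    field_simp
  have h2 : (∫ θ in (0 : ℝ)..2 * Real.pi, ∫ j : ℤ,
        deriv (circleMap 0 1) θ * circleMap 0 1 θ ^ (j - k - 1) ∂ν) =
      ∫ j : ℤ, (∮ z in C(0, 1), z ^ (j - k - 1)) ∂ν := by
    rw [intervalIntegral_integral_swap]
    · simp [circleIntegral]
    · have : IsFiniteMeasure (volume.restrict (Set.uIoc 0 (2 * Real.pi))) := by
        rw [Set.uIoc]; infer_instance
      refine Integrable.of_bound (C := 1) ?_ ?_
      · refine Measurable.aestronglyMeasurable ?_
        refine measurable_from_prod_countable_left fun j => ?_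
        have : Continuous fun θ : ℝ => deriv (circleMap 0 1) θ * circleMap 0 1 θ ^ (j - k - 1) := by
          simp only [deriv_circleMap]
          refine ((continuous_circleMap 0 1).mul continuous_const).mul ?_
          exact (continuous_circleMap 0 1).zpow₀ _ fun θ => Or.inl (hcm0 θ)
        exact this.measurable
      · refine Filter.Eventually.of_forall fun x => ?_
        simp [Function.uncurry]
  rw [h1, h2]
  simp_rw [circleIntegral_zpow_sub_one, sub_eq_zero]
  have : (fun j : ℤ => if j = k then (2 * Real.pi * Complex.I : ℂ) else 0) =
      Set.indicator {k} fun _ => (2 * Real.pi * Complex.I : ℂ) := by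
    ext j; simp [Set.indicator_apply]
  rw [this, integral_indicator_const _ (measurableSet_singleton k)]
  simp [mul_comm]

/-- Contour deformation: comparing each radius with the outer one `r` lets the coefficient integral
be moved between any two radii of the annulus. -/
lemma circleIntegral_inv_mul_eq_of_annulus {F : ℂ → ℂ} {r t : ℝ} (hr : 1 < r)
    (hF : ∀ z : ℂ, r⁻¹ ≤ ‖z‖ → ‖z‖ ≤ r → DifferentiableAt ℂ F z) (ht1 : r⁻¹ ≤ t) (ht2 : t ≤ r) :
    (∮ z in C(0, t), z⁻¹ * F z) = ∮ z in C(0, r), z⁻¹ * F z := by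
  have ht0 : 0 < t := (inv_pos.2 (zero_lt_one.trans hr)).trans_le ht1
  have h := Complex.circleIntegral_sub_center_inv_smul_eq_of_differentiable_on_annulus_off_countable
    (c := 0) ht0 ht2 (f := F) Set.countable_empty
    (fun z hz => by
      simp only [Set.mem_sdiff, Metric.mem_closedBall, dist_zero_right, Metric.mem_ball,
        not_lt] at hz
      exact (hF z (ht1.trans hz.2) hz.1).continuousAt.continuousWithinAt)
    (fun z hz => by
      simp only [Set.mem_sdiff, Metric.mem_closedBall, dist_zero_right, Metric.mem_ball,
        not_le, Set.mem_empty_iff_false, not_false_eq_true, and_true] at hz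
      exact hF z (ht1.trans hz.2.le) hz.1.le)
  simpa using h.symm

/-- A finite measure on `ℤ` whose generating function extends holomorphically to an annulus has
geometrically decaying atoms. -/
lemma exists_atom_le_of_annulus {ν : Measure ℤ} [IsFiniteMeasure ν] {F : ℂ → ℂ} {r t : ℝ}
    (hr : 1 < r) (hF : ∀ z : ℂ, r⁻¹ ≤ ‖z‖ → ‖z‖ ≤ r → DifferentiableAt ℂ F z)
    (hν : ∀ z ∈ Metric.sphere (0 : ℂ) 1, ∫ j : ℤ, z ^ j ∂ν = F z) (ht1 : r⁻¹ ≤ t) (ht2 : t ≤ r) :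
    ∃ C : ℝ, 0 ≤ C ∧ ∀ k : ℤ, ν.real {k} ≤ C * t ^ (-k) := by
  have hr0 : 0 < r := zero_lt_one.trans hr
  have ht0 : 0 < t := (inv_pos.2 hr0).trans_le ht1
  obtain ⟨C, hC⟩ := (isCompact_sphere (0 : ℂ) t).exists_bound_of_continuousOn (f := F)
    (fun z hz => by
      rw [mem_sphere_zero_iff_norm] at hz
      exact (hF z (hz ▸ ht1) (hz ▸ ht2)).continuousAt.continuousWithinAt)
  have hC0 : 0 ≤ C := (norm_nonneg _).trans (hC (t : ℂ) (by simp [abs_of_pos ht0]))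
  refine ⟨C, hC0, fun k => ?_⟩
  have hG : ∀ z : ℂ, r⁻¹ ≤ ‖z‖ → ‖z‖ ≤ r → DifferentiableAt ℂ (fun z => z ^ (-k) * F z) z := by
    intro z h1 h2
    have hz : z ≠ 0 := norm_pos_iff.1 ((inv_pos.2 hr0).trans_le h1)
    exact (differentiableAt_zpow.2 (Or.inl hz)).mul (hF z h1 h2)
  have h1 := circleIntegral_generatingFunction ν k
  have h2 : (∮ z in C(0, 1), z⁻¹ * (z ^ (-k) * ∫ j : ℤ, z ^ j ∂ν)) =
      ∮ z in C(0, 1), z⁻¹ * (z ^ (-k) * F z) :=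
    circleIntegral.integral_congr zero_le_one fun z hz => by simp only [hν z hz]
  rw [h2, circleIntegral_inv_mul_eq_of_annulus hr hG (inv_le_one_of_one_le₀ hr.le) hr.le,
    ← circleIntegral_inv_mul_eq_of_annulus hr hG ht1 ht2] at h1
  -- Cauchy estimate for the `k`-th Laurent coefficient on the circle of radius `t`.
  have h3 := circleIntegral.norm_integral_le_of_norm_le_const (c := 0) (R := t) ht0.le
    (f := fun z => z⁻¹ * (z ^ (-k) * F z)) (C := t⁻¹ * (t ^ (-k) * C)) (fun z hz => by
      have hz' := hz
      rw [mem_sphere_zero_iff_norm] at hz'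
      rw [norm_mul, norm_mul, norm_inv, norm_zpow, hz']
      gcongr
      exact hC z hz)
  rw [h1] at h3
  have h4 : ‖(2 * Real.pi * Complex.I * ν.real {k} : ℂ)‖ = 2 * Real.pi * ν.real {k} := by
    simp [abs_of_pos Real.pi_pos]
  rw [h4, show 2 * Real.pi * t * (t⁻¹ * (t ^ (-k) * C)) = 2 * Real.pi * (C * t ^ (-k)) by
    field_simp] at h3
  exact le_of_mul_le_mul_left h3 (by positivity)

/-- A finite measure on `ℤ` whose generating function extends holomorphically to an annulus has
exponential moments. -/
lemma lintegral_zpow_lt_top_of_annulus {ν : Measure ℤ} [IsFiniteMeasure ν] {F : ℂ → ℂ} {r s : ℝ}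
    (hr : 1 < r) (hF : ∀ z : ℂ, r⁻¹ ≤ ‖z‖ → ‖z‖ ≤ r → DifferentiableAt ℂ F z)
    (hν : ∀ z ∈ Metric.sphere (0 : ℂ) 1, ∫ j : ℤ, z ^ j ∂ν = F z) (hs1 : r⁻¹ < s) (hs2 : s < r) :
    ∫⁻ k : ℤ, ENNReal.ofReal (s ^ k) ∂ν < ∞ := by
  have hr0 : 0 < r := zero_lt_one.trans hr
  have hs0 : 0 < s := (inv_pos.2 hr0).trans hs1
  have hle : r⁻¹ ≤ r := hs1.le.trans hs2.le
  -- The outer radius `r` controls the atoms at `k ≥ 0`, the inner radius `r⁻¹` those at `k ≤ 0`.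
  obtain ⟨C, hC0, hC⟩ := exists_atom_le_of_annulus hr hF hν hle le_rfl
  obtain ⟨D, hD0, hD⟩ := exists_atom_le_of_annulus hr hF hν le_rfl hle
  have hsum : Summable fun k : ℤ => s ^ k * ν.real {k} := by
    refine Summable.of_nat_of_neg ?_ ?_
    · refine Summable.of_nonneg_of_le (fun k => by positivity) (fun k => ?_)
        ((summable_geometric_of_lt_one (r := s * r⁻¹) (by positivity) ?_).mul_left C)
      · calc s ^ (k : ℤ) * ν.real {(k : ℤ)} ≤ s ^ (k : ℤ) * (C * r ^ (-(k : ℤ))) := by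
              gcongr; exact hC k
          _ = C * (s * r⁻¹) ^ k := by rw [zpow_neg, mul_pow, inv_pow]; simp; ring
      · rw [← div_eq_mul_inv]; exact (div_lt_one hr0).2 hs2
    · refine Summable.of_nonneg_of_le (fun k => by positivity) (fun k => ?_)
        ((summable_geometric_of_lt_one (r := s⁻¹ * r⁻¹) (by positivity) ?_).mul_left D)
      · calc s ^ (-(k : ℤ)) * ν.real {-(k : ℤ)} ≤ s ^ (-(k : ℤ)) * (D * r⁻¹ ^ (-(-(k : ℤ)))) := by
              gcongr; exact hD _
          _ = D * (s⁻¹ * r⁻¹) ^ k := by rw [neg_neg, zpow_neg, mul_pow, inv_pow]; simp; ring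
      · rw [← div_eq_inv_mul]; exact (div_lt_one hs0).2 hs1
  rw [lintegral_countable']
  have : ∀ k : ℤ, ENNReal.ofReal (s ^ k) * ν {k} = ENNReal.ofReal (s ^ k * ν.real {k}) := by
    intro k
    rw [ENNReal.ofReal_mul (by positivity), measureReal_def, ENNReal.ofReal_toReal (by finiteness)]
  simp_rw [this]
  rw [← ENNReal.ofReal_tsum_of_nonneg (fun k => by positivity) hsum]
  exact ENNReal.ofReal_lt_top

/-- If the characteristic exponent of a finite measure on `ℤ` is a continuous quotient of
polynomials on the unit circle, then the measure has exponential moments. -/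
lemma exists_lintegral_zpow_lt_top {ν : Measure ℤ} [IsFiniteMeasure ν] {ψ : ℂ → ℂ}
    (hψ : ContinuousOn ψ (Metric.sphere 0 1)) {p q : Polynomial ℂ} (hq : q ≠ 0)
    (h : ∀ z ∈ Metric.sphere (0 : ℂ) 1, q.eval z * ψ z = p.eval z)
    (hν : ∀ z ∈ Metric.sphere (0 : ℂ) 1, ∫ j : ℤ, z ^ j ∂ν = Complex.exp (-ψ z)) :
    ∃ s : ℝ, 1 < s ∧ ∫⁻ k : ℤ, ENNReal.ofReal (s ^ k) ∂ν < ∞ ∧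
      ∫⁻ k : ℤ, ENNReal.ofReal (s⁻¹ ^ k) ∂ν < ∞ := by
  obtain ⟨p', q', hq0, hq', h'⟩ := exists_reduced_fraction_on_circle hψ hq h
  obtain ⟨r, hr, hqr⟩ := exists_annulus_eval_ne_zero hq0 hq'
  have hF : ∀ z : ℂ, r⁻¹ ≤ ‖z‖ → ‖z‖ ≤ r →
      DifferentiableAt ℂ (fun z => Complex.exp (-(p'.eval z / q'.eval z))) z := fun z h1 h2 =>
    ((p'.differentiableAt).div q'.differentiableAt (hqr z h1 h2)).neg.cexp
  have hν' : ∀ z ∈ Metric.sphere (0 : ℂ) 1,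
      ∫ j : ℤ, z ^ j ∂ν = Complex.exp (-(p'.eval z / q'.eval z)) := fun z hz => by
    rw [hν z hz, ← h' z hz, mul_div_cancel_left₀ _ (hq' z hz)]
  obtain ⟨s, hs1, hs2⟩ := exists_between hr
  have hs0 : 0 < s := zero_lt_one.trans hs1
  refine ⟨s, hs1, lintegral_zpow_lt_top_of_annulus hr hF hν' ?_ hs2,
    lintegral_zpow_lt_top_of_annulus hr hF hν' ?_ ?_⟩
  · exact (inv_lt_one_of_one_lt₀ hr).trans hs1
  · exact inv_strictAnti₀ hs0 hs2
  · exact (inv_lt_one_of_one_lt₀ hs1).trans hr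

/-! ### Mixed compound Poisson laws and their moments. -/

section MixedPoisson

/-- Convolution powers of a measure on `ℤ`. -/
def convPow (μ : Measure ℤ) : ℕ → Measure ℤ
  | 0 => Measure.dirac 0
  | j + 1 => convPow μ j ∗ μ

instance (μ : Measure ℤ) [IsProbabilityMeasure μ] (j : ℕ) : IsProbabilityMeasure (convPow μ j) := by
  induction j with
  | zero => unfold convPow; infer_instance
  | succ j ih => unfold convPow; infer_instance

lemma lintegral_convPow (μ : Measure ℤ) [IsProbabilityMeasure μ] {s : ℝ} (hs : 0 < s) (j : ℕ) :
    ∫⁻ k, ENNReal.ofReal (s ^ k) ∂(convPow μ j) = (∫⁻ k, ENNReal.ofReal (s ^ k) ∂μ) ^ j := by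
  induction j with
  | zero => simp [convPow]
  | succ j ih =>
    rw [convPow, Measure.lintegral_conv (by fun_prop), pow_succ, ← ih,
      ← lintegral_mul_const _ (by fun_prop)]
    refine lintegral_congr fun x => ?_
    rw [← lintegral_const_mul _ (by fun_prop)]
    refine lintegral_congr fun y => ?_
    rw [zpow_add₀ hs.ne', ENNReal.ofReal_mul (by positivity)]

lemma integrable_zpow_of_norm_eq_one {z : ℂ} (hz : ‖z‖ = 1) (μ : Measure ℤ) [IsFiniteMeasure μ] :
    Integrable (fun k : ℤ => z ^ k) μ :=
  Integrable.of_bound (C := 1) (by fun_prop) (Filter.Eventually.of_forall fun k => by simp [hz])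

lemma norm_integral_zpow_le_one {z : ℂ} (hz : ‖z‖ = 1) (μ : Measure ℤ) [IsProbabilityMeasure μ] :
    ‖∫ k : ℤ, z ^ k ∂μ‖ ≤ 1 := by
  simpa using norm_integral_le_of_norm_le_const (μ := μ) (f := fun k : ℤ => z ^ k) (C := 1)
    (Filter.Eventually.of_forall fun k => by simp [hz])

lemma integral_convPow (μ : Measure ℤ) [IsProbabilityMeasure μ] {z : ℂ} (hz : ‖z‖ = 1) (j : ℕ) :
    ∫ k, z ^ k ∂(convPow μ j) = (∫ k, z ^ k ∂μ) ^ j := by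
  have hz0 : z ≠ 0 := by rintro rfl; simp at hz
  induction j with
  | zero => simp [convPow]
  | succ j ih =>
    rw [convPow, integral_conv (integrable_zpow_of_norm_eq_one hz _), pow_succ, ← ih,
      ← integral_mul_const]
    refine integral_congr_ae (Filter.Eventually.of_forall fun x => ?_)
    simp only
    rw [← integral_const_mul]
    simp_rw [zpow_add₀ hz0]

variable {Ω : Type*} [MeasurableSpace Ω]

/-- The probabilities `E[e^{-X} X^j / j!]` of a mixed Poisson distribution. -/
def mixedPoissonWeight (P : Measure Ω) (X : Ω → ℝ) (j : ℕ) : ℝ≥0∞ :=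
  ∫⁻ ω, ENNReal.ofReal (Real.exp (-X ω) * (X ω ^ j / j.factorial)) ∂P

/-- Sum the series of `e^{cX}` inside the expectation. All terms are nonnegative, so this holds in
`[0, ∞]` even when the moment is infinite. -/
lemma tsum_mixedPoissonWeight_mul_pow {P : Measure Ω} {X : Ω → ℝ} (hX : Measurable X)
    (hX0 : ∀ᵐ ω ∂P, 0 ≤ X ω) {c : ℝ} (hc : 0 ≤ c) :
    ∑' j, mixedPoissonWeight P X j * ENNReal.ofReal c ^ j =
      ∫⁻ ω, ENNReal.ofReal (Real.exp ((c - 1) * X ω)) ∂P := by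
  have h1 : ∀ j, mixedPoissonWeight P X j * ENNReal.ofReal c ^ j = ∫⁻ ω,
      ENNReal.ofReal (Real.exp (-X ω) * (X ω ^ j / j.factorial)) * ENNReal.ofReal c ^ j ∂P :=
    fun j => (lintegral_mul_const _ (by fun_prop)).symm
  simp_rw [h1]
  rw [← lintegral_tsum (fun j => by fun_prop)]
  refine lintegral_congr_ae ?_
  filter_upwards [hX0] with ω hω
  have hs : HasSum (fun j : ℕ => Real.exp (-X ω) * ((c * X ω) ^ j / j.factorial))
      (Real.exp (-X ω) * Real.exp (c * X ω)) := by
    rw [Real.exp_eq_exp_ℝ]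
    exact (NormedSpace.expSeries_div_hasSum_exp (c * X ω)).mul_left _
  rw [show (c - 1) * X ω = -X ω + c * X ω by ring, Real.exp_add, ← hs.tsum_eq,
    ENNReal.ofReal_tsum_of_nonneg (fun j => by positivity) hs.summable]
  refine tsum_congr fun j => ?_
  rw [← ENNReal.ofReal_pow hc, ← ENNReal.ofReal_mul (by positivity), mul_pow]
  congr 1
  ring

/-- The mixed compound Poisson distribution with step law `μ` and mixing variable `X`. -/
def mixedPoisson (P : Measure Ω) (X : Ω → ℝ) (μ : Measure ℤ) : Measure ℤ :=
  Measure.sum fun j => mixedPoissonWeight P X j • convPow μ j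

variable {P : Measure Ω} {X : Ω → ℝ} {μ : Measure ℤ}
  [IsProbabilityMeasure μ]

lemma tsum_mixedPoissonWeight [IsProbabilityMeasure P] (hX : Measurable X)
    (hX0 : ∀ᵐ ω ∂P, 0 ≤ X ω) :
    ∑' j, mixedPoissonWeight P X j = 1 := by
  simpa using tsum_mixedPoissonWeight_mul_pow hX hX0 zero_le_one

lemma isFiniteMeasure_mixedPoisson [IsProbabilityMeasure P] (hX : Measurable X)
    (hX0 : ∀ᵐ ω ∂P, 0 ≤ X ω) :
    IsFiniteMeasure (mixedPoisson P X μ) := by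
  refine ⟨?_⟩
  simp [mixedPoisson, Measure.sum_apply, tsum_mixedPoissonWeight hX hX0]

lemma lintegral_zpow_mixedPoisson {s : ℝ} (hs : 0 < s) :
    ∫⁻ k, ENNReal.ofReal (s ^ k) ∂(mixedPoisson P X μ) =
      ∑' j, mixedPoissonWeight P X j * (∫⁻ k, ENNReal.ofReal (s ^ k) ∂μ) ^ j := by
  simp [mixedPoisson, lintegral_sum_measure, lintegral_convPow _ hs]

/-- Transfers exponential moments from the mixed law back to the mixing variable. The real lower
bound `c` replaces `∫ s^k dμ`, which may be infinite. -/
lemma lintegral_exp_le_lintegral_zpow_mixedPoisson (hX : Measurable X) (hX0 : ∀ᵐ ω ∂P, 0 ≤ X ω)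
    {s c : ℝ} (hs : 0 < s) (hc : 0 ≤ c) (h : ENNReal.ofReal c ≤ ∫⁻ k, ENNReal.ofReal (s ^ k) ∂μ) :
    ∫⁻ ω, ENNReal.ofReal (Real.exp ((c - 1) * X ω)) ∂P ≤
      ∫⁻ k, ENNReal.ofReal (s ^ k) ∂(mixedPoisson P X μ) := by
  rw [lintegral_zpow_mixedPoisson hs, ← tsum_mixedPoissonWeight_mul_pow hX hX0 hc]
  exact ENNReal.tsum_le_tsum fun j => by gcongr

/-- With `w = ∫ z^k dμ`, the sum `∑ e^{-X} (Xw)^j / j!` equals `e^{-(1-w)X}`. As `‖w‖ ≤ 1`, it is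
dominated by the Poisson weights, whose sum is `1`. -/
lemma integral_zpow_mixedPoisson [IsProbabilityMeasure P] (hX : Measurable X)
    (hX0 : ∀ᵐ ω ∂P, 0 ≤ X ω) {z : ℂ}
    (hz : ‖z‖ = 1) :
    ∫ k, z ^ k ∂(mixedPoisson P X μ) =
      ∫ ω, Complex.exp (-((1 - ∫ k, z ^ k ∂μ) * X ω)) ∂P := by
  have := isFiniteMeasure_mixedPoisson (μ := μ) hX hX0
  set w := ∫ k, z ^ k ∂μ with hw
  have hw1 : ‖w‖ ≤ 1 := norm_integral_zpow_le_one hz μ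
  have hsum := hasSum_integral_measure
    (f := fun k : ℤ => z ^ k) (integrable_zpow_of_norm_eq_one hz (mixedPoisson P X μ))
  simp_rw [integral_smul_measure, integral_convPow μ hz, ← hw] at hsum
  rw [← mixedPoisson] at hsum
  have hterm : ∀ j, (mixedPoissonWeight P X j).toReal • w ^ j =
      ∫ ω, ((Real.exp (-X ω) * (X ω ^ j / j.factorial) : ℝ) : ℂ) * w ^ j ∂P := by
    intro j
    rw [integral_mul_const, integral_complex_ofReal, integral_eq_lintegral_of_nonneg_ae _
      (by fun_prop)]
    · rfl
    · filter_upwards [hX0] with ω hω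
      simp only [Pi.zero_apply]
      positivity
  have hsum2 : HasSum (fun j => ∫ ω, ((Real.exp (-X ω) * (X ω ^ j / j.factorial) : ℝ) : ℂ)
      * w ^ j ∂P) (∫ ω, Complex.exp (-((1 - w) * X ω)) ∂P) := by
    refine hasSum_integral_of_dominated_convergence
      (fun j ω => Real.exp (-X ω) * (X ω ^ j / j.factorial)) ?_ ?_ ?_ ?_ ?_
    · intro j; fun_prop
    · intro j
      filter_upwards [hX0] with ω hω
      rw [norm_mul, Complex.norm_real, norm_pow, Real.norm_of_nonneg (by positivity)]
      exact mul_le_of_le_one_right (by positivity) (pow_le_one₀ (norm_nonneg _) hw1)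
    · refine Filter.Eventually.of_forall fun ω => ?_
      exact (NormedSpace.expSeries_div_summable (X ω)).mul_left _
    · refine (integrable_const (1 : ℝ)).congr (Filter.Eventually.of_forall fun ω => ?_)
      simp only
      rw [tsum_mul_left, (NormedSpace.expSeries_div_hasSum_exp (X ω)).tsum_eq,
        ← Real.exp_eq_exp_ℝ, ← Real.exp_add]
      simp
    · refine Filter.Eventually.of_forall fun ω => ?_
      have := (NormedSpace.expSeries_div_hasSum_exp ((X ω : ℂ) * w)).mul_left
        (Complex.exp (-(X ω : ℂ)))
      rw [← Complex.exp_eq_exp_ℂ, ← Complex.exp_add] at this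
      rw [show -((1 - w) * (X ω : ℂ)) = -(X ω : ℂ) + X ω * w by ring]
      convert! this using 2 with j
      push_cast
      rw [mul_pow]
      ring
  simp_rw [hterm] at hsum
  exact hsum.unique hsum2

/-- A nondegenerate law on `ℤ` has an exponential moment exceeding `1`. -/
lemma exists_one_lt_ofReal_le_lintegral_zpow (hμ : ∃ l : ℤ, l ≠ 0 ∧ μ {l} ≠ 0) {s : ℝ}
    (hs : 1 < s) :
    ∃ c : ℝ, 1 < c ∧ (ENNReal.ofReal c ≤ ∫⁻ k, ENNReal.ofReal (s ^ k) ∂μ ∨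
      ENNReal.ofReal c ≤ ∫⁻ k, ENNReal.ofReal (s⁻¹ ^ k) ∂μ) := by
  have hs0 : 0 < s := zero_lt_one.trans hs
  -- By the inequality `s^k + s^{-k} ≥ 2`, strict for `k ≠ 0`, both moments being at most `1` would
  -- force `μ` to be concentrated at `0`.
  have hmain : 1 < ∫⁻ k, ENNReal.ofReal (s ^ k) ∂μ ∨ 1 < ∫⁻ k, ENNReal.ofReal (s⁻¹ ^ k) ∂μ := by
    by_contra! hcon
    have hle : ∫⁻ k, (ENNReal.ofReal (s ^ k) + ENNReal.ofReal (s⁻¹ ^ k)) ∂μ ≤ 2 := by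
      rw [lintegral_add_left (by fun_prop)]
      exact (add_le_add hcon.1 hcon.2).trans_eq one_add_one_eq_two
    have hge : ∀ k : ℤ, 2 ≤ ENNReal.ofReal (s ^ k) + ENNReal.ofReal (s⁻¹ ^ k) ∧
        (k ≠ 0 → 2 < ENNReal.ofReal (s ^ k) + ENNReal.ofReal (s⁻¹ ^ k)) := by
      intro k
      rw [← ENNReal.ofReal_add (by positivity) (by positivity), inv_zpow,
        show (2 : ℝ≥0∞) = ENNReal.ofReal 2 by simp]
      have hx : 0 < s ^ k := by positivity
      have key : s ^ k + (s ^ k)⁻¹ - 2 = (s ^ k - 1) ^ 2 / s ^ k := by field_simp; ring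
      constructor
      · refine ENNReal.ofReal_le_ofReal ?_
        have : 0 ≤ (s ^ k - 1) ^ 2 / s ^ k := by positivity
        linarith
      · intro hk
        refine (ENNReal.ofReal_lt_ofReal_iff (by positivity)).2 ?_
        have h1 : s ^ k - 1 ≠ 0 := by
          rw [sub_ne_zero]
          exact fun h => hk ((zpow_eq_one_iff_right₀ hs0.le hs.ne').1 h)
        have : 0 < (s ^ k - 1) ^ 2 / s ^ k := by positivity
        linarith
    have heq : (fun _ : ℤ => (2 : ℝ≥0∞)) =ᵐ[μ]
        fun k => ENNReal.ofReal (s ^ k) + ENNReal.ofReal (s⁻¹ ^ k) := by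
      refine ae_eq_of_ae_le_of_lintegral_le (Filter.Eventually.of_forall fun k => (hge k).1)
        (by simp) (by fun_prop) (by simpa using hle)
    obtain ⟨l, hl, hml⟩ := hμ
    refine hml (measure_mono_null ?_ (ae_iff.1 heq))
    intro k hk
    rw [Set.mem_singleton_iff] at hk
    exact ((hge k).2 (hk ▸ hl)).ne
  rcases hmain with h | h
  all_goals
    obtain ⟨c, hc1, hc2⟩ := ENNReal.lt_iff_exists_real_btwn.1 h |>.imp fun c hc => hc.2
    refine ⟨c, ?_, by first | exact Or.inl hc2.le | exact Or.inr hc2.le⟩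
    rwa [← ENNReal.ofReal_one, ENNReal.ofReal_lt_ofReal_iff_of_nonneg zero_le_one] at hc1

end MixedPoisson

/-! ### Generic integer directions and finiteness of lattice balls. -/

/-- Take `a = (1, N, N², …)`: then `a·d` is the value at `N` of the polynomial with coefficients
`d_i`, and a finite product of nonzero integer polynomials has a non-root `N`. -/
lemma exists_dotProduct_ne_zero {n : ℕ} (D : Finset (Fin n → ℤ)) (hD : ∀ d ∈ D, d ≠ 0) :
    ∃ a : Fin n → ℤ, ∀ d ∈ D, a ⬝ᵥ d ≠ 0 := by
  let p : (Fin n → ℤ) → Polynomial ℤ := fun d => ∑ i, Polynomial.C (d i) * Polynomial.X ^ (i : ℕ)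
  have hp : ∀ d ∈ D, p d ≠ 0 := by
    intro d hd h0
    refine hD d hd (funext fun i => ?_)
    have := congrArg (fun q => Polynomial.coeff q i) h0
    simpa [p, Polynomial.finsetSum_coeff, Polynomial.coeff_X_pow, Fin.val_inj] using this
  have hprod : ∏ d ∈ D, p d ≠ 0 := Finset.prod_ne_zero_iff.2 hp
  obtain ⟨N, hN⟩ : ∃ N : ℤ, (∏ d ∈ D, p d).eval N ≠ 0 := by
    by_contra! hcon
    exact hprod (Polynomial.funext fun r => by simpa using hcon r)
  refine ⟨fun i => N ^ (i : ℕ), fun d hd h0 => hN ?_⟩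
  rw [Polynomial.eval_prod]
  refine Finset.prod_eq_zero hd ?_
  rw [← h0]
  simp [p, Polynomial.eval_finsetSum, dotProduct, mul_comm]

lemma finite_setOf_latticePoint_mem_ball {n : ℕ} (h : ℝ) :
    {k : Fin n → ℤ | latticePoint k ∈ Metric.ball (0 : EuclideanSpace ℝ (Fin n)) h}.Finite := by
  refine (Set.finite_Icc (fun _ => -⌈h⌉) (fun _ => ⌈h⌉)).subset fun k hk => ?_
  have hk : ‖latticePoint k‖ < h := by simpa using hk
  have hi : ∀ i, |k i| ≤ ⌈h⌉ := by
    intro i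
    have h1 : ‖(latticePoint k) i‖ ≤ ‖latticePoint k‖ := PiLp.norm_apply_le _ i
    have h2 : |(k i : ℝ)| ≤ ⌈h⌉ := by
      have : ‖(latticePoint k) i‖ = |(k i : ℝ)| := by simp [latticePoint]
      rw [← this]
      exact h1.trans (hk.le.trans (Int.le_ceil h))
    exact_mod_cast h2
  exact ⟨fun i => (abs_le.1 (hi i)).1, fun i => (abs_le.1 (hi i)).2⟩

/-! ### Fourier series on the torus and restriction to lines. -/

section Torus

variable {n : ℕ}

lemma fourierTransform_eq_sum {u : (Fin n → ℤ) → ℂ} {S : Finset (Fin n → ℤ)}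
    (hu : ∀ k ∉ S, u k = 0) (x : UnitAddTorus (Fin n)) :
    fourierTransform u x = ∑ k ∈ S, u k * UnitAddTorus.mFourier (-k) x :=
  tsum_eq_sum fun k hk => by simp [hu k hk]

/-- If `u` and `ψ(D)u` are finitely supported, then `ψ 𝓕u` is the transform of `ψ(D)u`. -/
lemma mul_fourierTransform_eq_sum {ψ : UnitAddTorus (Fin n) → ℂ} (hψ : Continuous ψ)
    {u : (Fin n → ℤ) → ℂ} {S : Finset (Fin n → ℤ)} (hu : ∀ k ∉ S, u k = 0)
    (hv : ∀ k ∉ S, symbolOp ψ u k = 0) (x : UnitAddTorus (Fin n)) :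
    ψ x * fourierTransform u x = ∑ k ∈ S, symbolOp ψ u k * UnitAddTorus.mFourier (-k) x := by
  have hc : Continuous (fourierTransform u) := by
    rw [show fourierTransform u = _ from funext (fourierTransform_eq_sum hu)]
    fun_prop
  let G : C(UnitAddTorus (Fin n), ℂ) := ⟨fun x => ψ x * fourierTransform u x, hψ.mul hc⟩
  have hcoeff : ∀ k, UnitAddTorus.mFourierCoeff G (-k) = symbolOp ψ u k := fun k => rfl
  -- Only finitely many coefficients are nonzero, so the continuous function equals its Fourier
  -- series at every point, not just almost everywhere.
  have hsumm : Summable (UnitAddTorus.mFourierCoeff G) := by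
    rw [← (Equiv.neg (Fin n → ℤ)).summable_iff]
    exact summable_of_ne_finset_zero (s := S) fun k hk => by
      simpa using (hcoeff k).trans (hv k hk)
  have h1 := UnitAddTorus.hasSum_mFourier_series_apply_of_summable hsumm x
  rw [← (Equiv.neg (Fin n → ℤ)).hasSum_iff] at h1
  refine h1.unique (hasSum_sum_of_ne_finset_zero fun k hk => ?_)
  simp only [Function.comp_apply, Equiv.neg_apply, hcoeff, hv k hk, zero_smul]

/-- The one-parameter subgroup of the torus in the integer direction `a`. -/
def torusLine (a : Fin n → ℤ) (t : ℝ) : UnitAddTorus (Fin n) :=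
  fun i => ((a i * t : ℝ) : UnitAddCircle)

lemma mFourier_torusLine (a l : Fin n → ℤ) (t : ℝ) :
    UnitAddTorus.mFourier l (torusLine a t) =
      Complex.exp (2 * Real.pi * Complex.I * t) ^ (a ⬝ᵥ l) := by
  change ∏ i, fourier (l i) (torusLine a t i) = _
  simp only [torusLine, fourier_coe_apply]
  rw [← Complex.exp_sum, ← Complex.exp_int_mul, dotProduct]
  congr 1
  push_cast
  rw [Finset.sum_mul]
  refine Finset.sum_congr rfl fun i _ => ?_
  simp
  ring

lemma exists_exp_eq_of_norm_eq_one {z : ℂ} (hz : ‖z‖ = 1) :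
    ∃ t : ℝ, Complex.exp (2 * Real.pi * Complex.I * t) = z := by
  refine ⟨z.arg / (2 * Real.pi), ?_⟩
  conv_rhs => rw [← Complex.norm_mul_exp_arg_mul_I z, hz]
  have : (Real.pi : ℂ) ≠ 0 := by exact_mod_cast Real.pi_ne_zero
  push_cast
  rw [one_mul]
  congr 1
  field_simp

end Torus

/-! ### The exponent of the walk and its projections to `ℤ`. -/

section Walk

variable {n : ℕ} {Ω : Type*} [MeasurableSpace Ω] {P : Measure Ω}
  {R : ℕ → Ω → (Fin n → ℤ)}

lemma norm_mFourier_apply (l : Fin n → ℤ) (x : UnitAddTorus (Fin n)) :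
    ‖UnitAddTorus.mFourier l x‖ ≤ 1 :=
  ((UnitAddTorus.mFourier l).norm_coe_le_norm x).trans_eq UnitAddTorus.mFourier_norm

lemma integrable_mFourier_walk [IsProbabilityMeasure P] (hR : Measurable (R 1))
    (x : UnitAddTorus (Fin n)) :
    Integrable (fun ω => UnitAddTorus.mFourier (R 1 ω) x) P :=
  Integrable.of_bound (C := 1)
    ((measurable_of_countable fun l => UnitAddTorus.mFourier l x).comp hR).aestronglyMeasurable
    (Filter.Eventually.of_forall fun _ => norm_mFourier_apply _ _)

lemma walkExponent_eq_integral [IsProbabilityMeasure P] (hR : Measurable (R 1))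
    (x : UnitAddTorus (Fin n)) :
    walkExponent P R x = 1 - ∫ ω, UnitAddTorus.mFourier (R 1 ω) x ∂P := by
  have hprob : IsProbabilityMeasure (P.map (R 1)) := Measure.isProbabilityMeasure_map hR.aemeasurable
  have hm : Measurable fun l : Fin n → ℤ => 1 - UnitAddTorus.mFourier l x := measurable_of_countable _
  have hint : Integrable (fun l : Fin n → ℤ => 1 - UnitAddTorus.mFourier l x) (P.map (R 1)) := by
    refine Integrable.of_bound (C := 2) hm.aestronglyMeasurable
      (Filter.Eventually.of_forall fun l => (norm_sub_le _ _).trans ?_)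
    have := norm_mFourier_apply l x
    simp only [norm_one]
    linarith
  have h1 : ∫ l, (1 - UnitAddTorus.mFourier l x) ∂(P.map (R 1)) = walkExponent P R x := by
    rw [integral_countable hint, walkExponent]
    refine tsum_congr fun l => ?_
    rw [stepProb, measureReal_def, measureReal_def, Measure.map_apply hR (measurableSet_singleton l)]
    rfl
  rw [← h1, integral_map hR.aemeasurable hm.aestronglyMeasurable,
    integral_sub (integrable_const _) (integrable_mFourier_walk hR x)]
  simp

lemma norm_integral_mFourier_walk_le [IsProbabilityMeasure P] (x : UnitAddTorus (Fin n)) :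
    ‖∫ ω, UnitAddTorus.mFourier (R 1 ω) x ∂P‖ ≤ 1 := by
  simpa using norm_integral_le_of_norm_le_const (μ := P) (C := 1)
    (Filter.Eventually.of_forall fun ω => norm_mFourier_apply (R 1 ω) x)

lemma re_one_sub_nonneg {w : ℂ} (hw : ‖w‖ ≤ 1) : 0 ≤ (1 - w).re := by
  simpa using (Complex.re_le_norm w).trans hw

lemma continuous_subordinateExponent [IsProbabilityMeasure P] {β : ℝ} {ρ : Measure ℝ}
    (hρ : IsBernsteinPair β ρ)
    (hR : Measurable (R 1)) : Continuous (subordinateExponent P R β ρ) := by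
  have hw : Continuous (walkExponent P R) := by
    rw [show walkExponent P R = _ from funext (walkExponent_eq_integral hR)]
    refine continuous_const.sub (continuous_of_dominated (bound := fun _ => 1) ?_ ?_ ?_ ?_)
    · exact fun x => (integrable_mFourier_walk hR x).aestronglyMeasurable
    · exact fun x => Filter.Eventually.of_forall fun ω => norm_mFourier_apply _ _
    · exact integrable_const _
    · exact Filter.Eventually.of_forall fun ω => (UnitAddTorus.mFourier (R 1 ω)).continuous
  refine hρ.continuousOn.comp_continuous hw fun x => ?_
  rw [walkExponent_eq_integral hR]
  exact re_one_sub_nonneg (norm_integral_mFourier_walk_le x)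

/-- The law on `ℤ` of the first step in the integer direction `a`. -/
def directionalLaw (P : Measure Ω) (R : ℕ → Ω → (Fin n → ℤ)) (a : Fin n → ℤ) : Measure ℤ :=
  P.map fun ω => a ⬝ᵥ R 1 ω

lemma measurable_dotProduct_walk (hR : Measurable (R 1)) (a : Fin n → ℤ) :
    Measurable fun ω => a ⬝ᵥ R 1 ω :=
  (measurable_of_countable fun l => a ⬝ᵥ l).comp hR

/-- Reduction to dimension one: along direction `a` only the law of the integer step `a·R₁` is seen.
-/
lemma subordinateExponent_torusLine [IsProbabilityMeasure P] {β : ℝ} {ρ : Measure ℝ}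
    (hR : Measurable (R 1))
    (a : Fin n → ℤ) (t : ℝ) :
    subordinateExponent P R β ρ (torusLine a t) = bernsteinC β ρ
      (1 - ∫ k : ℤ, Complex.exp (2 * Real.pi * Complex.I * t) ^ k ∂(directionalLaw P R a)) := by
  rw [subordinateExponent, walkExponent_eq_integral hR, directionalLaw,
    integral_map (measurable_dotProduct_walk hR a).aemeasurable
      (measurable_of_countable _).aestronglyMeasurable]
  simp_rw [mFourier_torusLine]

lemma IsRandomWalk.exists_measure_ne_zero (hR : IsRandomWalk P R) :
    ∃ l : Fin n → ℤ, l ≠ 0 ∧ P {ω | R 1 ω = l} ≠ 0 := by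
  by_contra! hcon
  refine hR.nondegenerate ?_
  have : ∀ᵐ ω ∂P, ∀ l : Fin n → ℤ, l ≠ 0 → R 1 ω ≠ l := by
    rw [ae_all_iff]
    intro l
    by_cases hl : l = 0
    · simp [hl]
    · have := hcon l hl
      rw [ae_iff]
      simpa [hl] using this
  filter_upwards [this] with ω hω
  by_contra hne
  exact hω _ hne rfl

lemma directionalLaw_ne_zero (hR : Measurable (R 1)) {a l : Fin n → ℤ} (hal : a ⬝ᵥ l ≠ 0)
    (hl : P {ω | R 1 ω = l} ≠ 0) : ∃ k : ℤ, k ≠ 0 ∧ directionalLaw P R a {k} ≠ 0 := by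
  refine ⟨a ⬝ᵥ l, hal, fun h0 => hl ?_⟩
  rw [directionalLaw, Measure.map_apply (measurable_dotProduct_walk hR a)
    (measurableSet_singleton _)] at h0
  refine measure_mono_null (fun ω hω => ?_) h0
  have hω : R 1 ω = l := hω
  simp [hω]

end Walk

/-! ### Trigonometric polynomials along a line as polynomials in `z`. -/

/-- The polynomial `X ^ K * ∑_{k ∈ S} c_k X ^ (-a·k)`, provided `a·k ≤ K` on `S`. -/
def linePolynomial {n : ℕ} (a : Fin n → ℤ) (S : Finset (Fin n → ℤ)) (K : ℤ)
    (c : (Fin n → ℤ) → ℂ) : Polynomial ℂ :=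
  ∑ k ∈ S, Polynomial.C (c k) * Polynomial.X ^ (K - a ⬝ᵥ k).toNat

section LinePolynomial

variable {n : ℕ} {a : Fin n → ℤ} {S : Finset (Fin n → ℤ)} {K : ℤ} {c : (Fin n → ℤ) → ℂ}

lemma eval_linePolynomial (hK : ∀ k ∈ S, a ⬝ᵥ k ≤ K) {z : ℂ} (hz : z ≠ 0) :
    (linePolynomial a S K c).eval z = z ^ K * ∑ k ∈ S, c k * z ^ (a ⬝ᵥ (-k)) := by
  rw [linePolynomial, Polynomial.eval_finsetSum, Finset.mul_sum]
  refine Finset.sum_congr rfl fun k hk => ?_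
  have h1 : z ^ (K - a ⬝ᵥ k).toNat = z ^ (K - a ⬝ᵥ k) := by
    rw [← zpow_natCast, Int.toNat_of_nonneg (sub_nonneg.2 (hK k hk))]
  simp only [Polynomial.eval_mul, Polynomial.eval_C, Polynomial.eval_pow, Polynomial.eval_X]
  rw [h1, dotProduct_neg, sub_eq_add_neg, zpow_add₀ hz]
  ring

/-- Injectivity of `a` on `S` keeps the exponents `K - a·k` distinct, and `a·k ≤ K` prevents `toNat`
from merging them. So the coefficient `c k` survives. -/
lemma linePolynomial_ne_zero (hK : ∀ k ∈ S, a ⬝ᵥ k ≤ K)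
    (ha : ∀ k ∈ S, ∀ l ∈ S, a ⬝ᵥ k = a ⬝ᵥ l → k = l) {k : Fin n → ℤ} (hk : k ∈ S)
    (hc : c k ≠ 0) : linePolynomial a S K c ≠ 0 := by
  intro h0
  have h1 := congrArg (fun q => Polynomial.coeff q (K - a ⬝ᵥ k).toNat) h0
  simp only [linePolynomial, Polynomial.finsetSum_coeff, Polynomial.coeff_C_mul,
    Polynomial.coeff_X_pow, Polynomial.coeff_zero] at h1
  rw [Finset.sum_eq_single k (fun l hl hlk => ?_) (fun h => absurd hk h)] at h1
  · simp [hc] at h1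
  · have : (K - a ⬝ᵥ k).toNat ≠ (K - a ⬝ᵥ l).toNat := by
      intro h
      refine hlk (ha l hl k hk ?_)
      have h2 := hK k hk
      have h3 := hK l hl
      omega
    simp [this]

end LinePolynomial

/-! ### The contradiction and the main theorem. -/

/-- If the subordinator has no positive exponential moments, then the exponent of a nondegenerate
subordinate walk on `ℤ` is not a quotient of polynomials on the unit circle. -/
lemma not_rational_subordinateExponent {Ω : Type*} [MeasurableSpace Ω] {P : Measure Ω}
    [IsProbabilityMeasure P] {T : ℝ≥0 → Ω → ℝ} {β : ℝ} {ρ : Measure ℝ}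
    (hT : IsSubordinatorWith P T β ρ) (hmom : NoExponentialMoments P T) {μ : Measure ℤ}
    [IsProbabilityMeasure μ] (hμ : ∃ l : ℤ, l ≠ 0 ∧ μ {l} ≠ 0) {p q : Polynomial ℂ} (hq : q ≠ 0)
    (h : ∀ z ∈ Metric.sphere (0 : ℂ) 1,
      q.eval z * bernsteinC β ρ (1 - ∫ k : ℤ, z ^ k ∂μ) = p.eval z) : False := by
  have hX := hT.subordinator.measurable 1
  have hX0 := hT.subordinator.nonneg 1
  have := isFiniteMeasure_mixedPoisson (μ := μ) hX hX0
  have hcont : ContinuousOn (fun z : ℂ => bernsteinC β ρ (1 - ∫ k : ℤ, z ^ k ∂μ))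
      (Metric.sphere 0 1) := by
    refine hT.pair.continuousOn.comp (continuousOn_const.sub ?_) fun z hz =>
      re_one_sub_nonneg (norm_integral_zpow_le_one (by simpa using hz) μ)
    refine continuousOn_of_dominated (bound := fun _ => 1) ?_ ?_ (integrable_const _) ?_
    · exact fun z _ => (measurable_of_countable _).aestronglyMeasurable
    · intro z hz
      have hz : ‖z‖ = 1 := by simpa using hz
      exact Filter.Eventually.of_forall fun k => by simp [hz]
    · refine Filter.Eventually.of_forall fun k => continuousOn_id.zpow₀ k fun z hz => Or.inl ?_
      rintro rfl
      simp at hz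
  obtain ⟨s, hs, h1, h2⟩ := exists_lintegral_zpow_lt_top (ν := mixedPoisson P (T 1) μ) hcont hq h
    fun z hz => by
      have hz : ‖z‖ = 1 := by simpa using hz
      rw [integral_zpow_mixedPoisson hX hX0 hz,
        hT.laplace_one_sub (norm_integral_zpow_le_one hz μ)]
  obtain ⟨c, hc, hc'⟩ := exists_one_lt_ofReal_le_lintegral_zpow hμ hs
  have hc0 : 0 ≤ c := zero_le_one.trans hc.le
  have hs0 : 0 < s := zero_lt_one.trans hs
  -- The infinite moment of order `c - 1 > 0` at time `1` contradicts finiteness at `s` or at `s⁻¹`,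
  -- whichever has its `μ`-moment at least `c`.
  have htop := hmom (c - 1) (sub_pos.2 hc) 1 one_pos
  rcases hc' with hc' | hc'
  · exact ((lintegral_exp_le_lintegral_zpow_mixedPoisson hX hX0 hs0 hc0 hc').trans_lt h1).ne htop
  · exact ((lintegral_exp_le_lintegral_zpow_mixedPoisson hX hX0 (inv_pos.2 hs0) hc0 hc').trans_lt
      h2).ne htop

end DiscreteLevy

end

theorem mainTheorem3 {n : ℕ}
    {Ω : Type*} [MeasurableSpace Ω] (P : Measure Ω) [IsProbabilityMeasure P]
    {Ω' : Type*} [MeasurableSpace Ω'] (P' : Measure Ω') [IsProbabilityMeasure P']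
    (β : ℝ) (ρ : Measure ℝ) (T : ℝ≥0 → Ω → ℝ)
    (hT : DiscreteLevy.IsSubordinatorWith P T β ρ)
    (hmom : DiscreteLevy.NoExponentialMoments P T)
    (R : ℕ → Ω' → (Fin n → ℤ)) (hR : DiscreteLevy.IsRandomWalk P' R)
    (h : ℝ) (hh : 1 < h) (u : (Fin n → ℤ) → ℂ)
    (hu : ∀ k : Fin n → ℤ,
      DiscreteLevy.latticePoint k ∉ Metric.ball (0 : EuclideanSpace ℝ (Fin n)) h →
        DiscreteLevy.symbolOp (DiscreteLevy.subordinateExponent P' R β ρ) u k = 0 ∧ u k = 0) :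
    ∀ k : Fin n → ℤ, u k = 0 := by
  classical
  set S := (DiscreteLevy.finite_setOf_latticePoint_mem_ball (n := n) h).toFinset with hS
  have hSu : ∀ k ∉ S, u k = 0 := fun k hk => (hu k (by simpa [hS] using hk)).2
  have hSv : ∀ k ∉ S, DiscreteLevy.symbolOp (DiscreteLevy.subordinateExponent P' R β ρ) u k = 0 :=
    fun k hk => (hu k (by simpa [hS] using hk)).1
  by_contra! hne
  obtain ⟨k₀, hk₀⟩ := hne
  have hk₀S : k₀ ∈ S := by
    by_contra hk
    exact hk₀ (hSu k₀ hk)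
  have hR1 := hR.measurable 1
  obtain ⟨l, hl, hPl⟩ := hR.exists_measure_ne_zero
  -- Avoiding `l` keeps the projected walk nondegenerate; avoiding the nonzero differences of points
  -- of `S` makes `a` injective on `S`.
  obtain ⟨a, ha⟩ := DiscreteLevy.exists_dotProduct_ne_zero
    (insert l (((S ×ˢ S).image fun k => k.1 - k.2).erase 0)) (by
      intro d hd
      rcases Finset.mem_insert.1 hd with rfl | hd
      · exact hl
      · exact Finset.ne_of_mem_erase hd)
  have hal : a ⬝ᵥ l ≠ 0 := ha l (Finset.mem_insert_self _ _)
  have hinj : ∀ k ∈ S, ∀ l ∈ S, a ⬝ᵥ k = a ⬝ᵥ l → k = l := by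
    intro k hk m hm hkm
    by_contra hne
    refine ha (k - m) (Finset.mem_insert_of_mem (Finset.mem_erase.2 ⟨sub_ne_zero.2 hne, ?_⟩)) ?_
    · exact Finset.mem_image.2 ⟨(k, m), Finset.mem_product.2 ⟨hk, hm⟩, rfl⟩
    · rw [dotProduct_sub, hkm, sub_self]
  obtain ⟨K, hK⟩ : ∃ K : ℤ, ∀ k ∈ S, a ⬝ᵥ k ≤ K := by
    obtain ⟨K, hK⟩ := (S.image fun k => a ⬝ᵥ k).bddAbove
    exact ⟨K, fun k hk => hK (by simpa using ⟨k, hk, rfl⟩)⟩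
  have hprob : IsProbabilityMeasure (DiscreteLevy.directionalLaw P' R a) :=
    Measure.isProbabilityMeasure_map (DiscreteLevy.measurable_dotProduct_walk hR1 a).aemeasurable
  refine DiscreteLevy.not_rational_subordinateExponent hT hmom
    (DiscreteLevy.directionalLaw_ne_zero hR1 hal hPl)
    (q := DiscreteLevy.linePolynomial a S K u)
    (p := DiscreteLevy.linePolynomial a S K
      (DiscreteLevy.symbolOp (DiscreteLevy.subordinateExponent P' R β ρ) u))
    (DiscreteLevy.linePolynomial_ne_zero hK hinj hk₀S hk₀) fun z hz => ?_
  have hz : ‖z‖ = 1 := by simpa using hz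
  have hz0 : z ≠ 0 := by rintro rfl; simp at hz
  obtain ⟨t, rfl⟩ := DiscreteLevy.exists_exp_eq_of_norm_eq_one hz
  have hmain := DiscreteLevy.mul_fourierTransform_eq_sum
    (DiscreteLevy.continuous_subordinateExponent hT.pair hR1) hSu hSv (DiscreteLevy.torusLine a t)
  rw [DiscreteLevy.fourierTransform_eq_sum hSu, DiscreteLevy.subordinateExponent_torusLine hR1]
    at hmain
  simp_rw [DiscreteLevy.mFourier_torusLine] at hmain
  rw [DiscreteLevy.eval_linePolynomial hK hz0, DiscreteLevy.eval_linePolynomial hK hz0, ← hmain]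
  ring
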